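/- Let $G$ be a real, connected, finite-dimensional Lie group (not necessarily compact), $G\neq\{e\}$, whose Lie algebra is semisimple. Let $\mathcal{X}$ be a linear vector field on $G$, that is, a smooth vector field whose flow $(\varphi_t)_{t\in\mathbb{R}}$ is a family of automorphisms of the Lie group $G$. Let $g\in G$ be a fixed point of the flow, that is, $\varphi_t(g)=g$ for all $t\in\mathbb{R}$. Then: 1. $g$ is not asymptotically stable. Here $g$ is called stable if for every neighborhood $U$ of $g$ there is a neighborhood $V$ of $g$ with $\varphi_t(V)\subset U$ for all $t\ge 0$, and asymptotically stable if it is stable and there is a neighborhood $W$ of $g$ such that $\lim_{t\to\infty}\varphi_t(x)=g$ for all $x\in W$. 2. $g$ is not exponentially stable. That is, for the distance $\varrho$ of any smooth Riemannian metric on $G$ (in particular of any left invariant one), there do not exist constants $c,\mu>0$ and a neighborhood $W$ of $g$ such that $\varrho(\varphi_t(x),g)\le c\,e^{-\mu t}\varrho(x,g)$ for all $x\in W$ and all $t\ge 0$. -/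

import Mathlib

open scoped Manifold ContDiff Topology Bundle

noncomputable section

namespace LinearFlow

/-- Over `ℝ` the Lie algebra of a Lie group only needs `C^3` smoothness, so that a smooth Lie group
has one. -/
instance instLEInftyMinSmoothness : ENat.LEInfty (minSmoothness ℝ 3) :=
  ⟨by rw [minSmoothness_of_isRCLikeNormedField]; exact ENat.LEInfty.out⟩

variable {E : Type*} [NormedAddCommGroup E] [NormedSpace ℝ E]
  {G : Type*} [TopologicalSpace G] [ChartedSpace E G]

/-- `φ` is the (global) flow of the vector field `X`: for each `g`, the curve `t ↦ φ t g` is the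
solution of `ġ = X(g)` starting at `g`. -/
def IsFlow (X : ∀ g : G, TangentSpace 𝓘(ℝ, E) g) (φ : ℝ → G → G) : Prop :=
  ∀ g : G, φ 0 g = g ∧ IsMIntegralCurve (I := 𝓘(ℝ, E)) (fun t => φ t g) X

/-- `f` is an automorphism of the Lie group `G`: a group automorphism which is smooth and has a
smooth inverse. -/
def IsLieGroupAutomorphism (E : Type*) [NormedAddCommGroup E] [NormedSpace ℝ E]
    {G : Type*} [TopologicalSpace G] [ChartedSpace E G] [Group G] (f : G → G) : Prop :=
  ∃ F : G ≃* G, (∀ g, F g = f g) ∧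
    ContMDiff 𝓘(ℝ, E) 𝓘(ℝ, E) ∞ F ∧ ContMDiff 𝓘(ℝ, E) 𝓘(ℝ, E) ∞ F.symm

/-- A linear vector field on `G`: a smooth vector field whose flow consists of automorphisms of
the Lie group `G`. -/
def IsLinearVectorField [IsManifold 𝓘(ℝ, E) 1 G] [Group G]
    (X : ∀ g : G, TangentSpace 𝓘(ℝ, E) g) : Prop :=
  ContMDiff 𝓘(ℝ, E) 𝓘(ℝ, E).tangent ∞
      (fun g => (⟨g, X g⟩ : TangentBundle 𝓘(ℝ, E) G)) ∧
    ∃ φ : ℝ → G → G, IsFlow X φ ∧ ∀ t, IsLieGroupAutomorphism E (φ t)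

/-- `g` is a fixed point of the flow `φ`. -/
def IsFixedPoint {G : Type*} (φ : ℝ → G → G) (g : G) : Prop :=
  ∀ t, φ t g = g

/-- `g` is stable: each neighborhood `U` of `g` contains `φ t (V)`, `t ≥ 0`, for some neighborhood
`V` of `g`. -/
def IsStable {G : Type*} [TopologicalSpace G] (φ : ℝ → G → G) (g : G) : Prop :=
  ∀ U ∈ 𝓝 g, ∃ V ∈ 𝓝 g, ∀ t : ℝ, 0 ≤ t → φ t '' V ⊆ U

/-- `g` is asymptotically stable: it is stable and attracts a neighborhood of itself. -/
def IsAsymptoticallyStable {G : Type*} [TopologicalSpace G] (φ : ℝ → G → G) (g : G) : Prop :=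
  IsStable φ g ∧
    ∃ W ∈ 𝓝 g, ∀ x ∈ W, Filter.Tendsto (fun t => φ t x) Filter.atTop (𝓝 g)

/-- The distance of the Riemannian metric `m` on `G`, i.e. the infimum of the lengths of the
`C^1` paths between two points. It is finite if `G` is connected. -/
def metricDist [IsManifold 𝓘(ℝ, E) 1 G]
    (m : Bundle.ContMDiffRiemannianMetric 𝓘(ℝ, E) ∞ E
      (fun x : G => TangentSpace 𝓘(ℝ, E) x))
    (x y : G) : ENNReal :=
  letI : Bundle.RiemannianBundle (fun x : G => TangentSpace 𝓘(ℝ, E) x) :=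
    ⟨m.toRiemannianMetric⟩
  Manifold.riemannianEDist 𝓘(ℝ, E) x y

/-- `g` is exponentially stable with respect to the distance `ϱ` of the Riemannian metric `m`:
`ϱ(φ_t(x), g) ≤ c e^{-μ t} ϱ(x, g)` for all `t ≥ 0` and all `x` in a neighborhood of `g`, with
constants `c, μ > 0`. -/
def IsExponentiallyStable [IsManifold 𝓘(ℝ, E) 1 G]
    (m : Bundle.ContMDiffRiemannianMetric 𝓘(ℝ, E) ∞ E
      (fun x : G => TangentSpace 𝓘(ℝ, E) x))
    (φ : ℝ → G → G) (g : G) : Prop :=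
  ∃ c μ : ℝ, 0 < c ∧ 0 < μ ∧ ∃ W ∈ 𝓝 g, ∀ x ∈ W, ∀ t : ℝ, 0 ≤ t →
    metricDist m (φ t x) g ≤ ENNReal.ofReal (c * Real.exp (-μ * t)) * metricDist m x g

end LinearFlow

end

/-! Left translation by a fixed point commutes with the automorphisms, so an asymptotically stable
fixed point makes the identity asymptotically stable. Each automorphism `F` maps an integral curve
`γ` of the left invariant field of `v` to one of the left invariant field of `dF v`. Near the
identity such a curve runs almost straight in the chart, so `‖dF v‖` is controlled by the
displacement of `F (γ a)` from the identity, which tends to `0` along the flow. The Lie algebra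
thus has automorphisms `A` with `A x → 0` for every `x`. As `ad (A x) → 0` is conjugate to `ad x`,
the characteristic polynomial of `ad x` is a power of `X`, and the Lie algebra is nilpotent by
Engel's theorem. A nonzero semisimple Lie algebra is not. Exponential stability implies asymptotic
stability because the Riemannian distance induces the topology. -/

namespace LinearFlow

open Filter VectorField

section LieAlgebra

theorem continuous_coeff_charpoly {𝕜 V M : Type*} [NontriviallyNormedField 𝕜] [CompleteSpace 𝕜]
    [AddCommGroup V] [Module 𝕜 V] [FiniteDimensional 𝕜 V] [TopologicalSpace V]
    [IsTopologicalAddGroup V] [ContinuousSMul 𝕜 V] [T2Space V]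
    [AddCommGroup M] [Module 𝕜 M] [FiniteDimensional 𝕜 M]
    (f : V →ₗ[𝕜] Module.End 𝕜 M) (n : ℕ) : Continuous fun v => (f v).charpoly.coeff n := by
  let b := Module.finBasis 𝕜 V
  simp_rw [← f.polyCharpoly_coeff_eval b]
  exact (MvPolynomial.continuous_eval _).comp b.equivFunL.continuous

theorem isNilpotent_of_tendsto_lieEquiv_zero {𝕜 L ι : Type*} [NontriviallyNormedField 𝕜]
    [CompleteSpace 𝕜] [LieRing L] [LieAlgebra 𝕜 L] [FiniteDimensional 𝕜 L] [TopologicalSpace L]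
    [IsTopologicalAddGroup L] [ContinuousSMul 𝕜 L] [T2Space L] {l : Filter ι} [l.NeBot]
    {A : ι → L ≃ₗ⁅𝕜⁆ L} (hA : ∀ x, Tendsto (fun i => A i x) l (𝓝 0)) : LieRing.IsNilpotent L := by
  refine (LieAlgebra.isNilpotent_iff_forall (R := 𝕜)).2 fun x => ?_
  have charpoly_ad_eq (i : ι) :
      (LieAlgebra.ad 𝕜 L (A i x)).charpoly = (LieAlgebra.ad 𝕜 L x).charpoly := by
    rw [← LieAlgebra.conj_ad_apply, LinearEquiv.charpoly_conj]
  have continuous_coeff (n : ℕ) : Continuous fun y => (LieAlgebra.ad 𝕜 L y).charpoly.coeff n :=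
    continuous_coeff_charpoly (LieAlgebra.ad 𝕜 L : L →ₗ[𝕜] Module.End 𝕜 L) n
  rw [LinearMap.isNilpotent_iff_charpoly]
  ext n
  have tendsto_coeff := ((continuous_coeff n).tendsto 0).comp (hA x)
  simp only [Function.comp_def, charpoly_ad_eq, map_zero, LinearMap.charpoly_zero] at tendsto_coeff
  exact tendsto_nhds_unique tendsto_const_nhds tendsto_coeff

theorem not_isNilpotent_of_hasTrivialRadical (R L : Type*) [CommRing R] [LieRing L]
    [LieAlgebra R L] [LieAlgebra.HasTrivialRadical R L] [Nontrivial L] :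
    ¬ LieRing.IsNilpotent L := by
  intro h
  exact top_ne_bot (LieAlgebra.HasTrivialRadical.eq_bot_of_isSolvable (⊤ : LieIdeal R L))

end LieAlgebra

section Differential

variable {𝕜 : Type*} [NontriviallyNormedField 𝕜]
  {E H G : Type*} [NormedAddCommGroup E] [NormedSpace 𝕜 E] [TopologicalSpace H]
  {I : ModelWithCorners 𝕜 E H} [TopologicalSpace G] [ChartedSpace H G] [Group G]
  {E' H' G' : Type*} [NormedAddCommGroup E'] [NormedSpace 𝕜 E'] [TopologicalSpace H']
  {J : ModelWithCorners 𝕜 E' H'} [TopologicalSpace G'] [ChartedSpace H' G'] [Group G']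

variable (I J) in
/-- The differential at `1` of a map `f` between Lie groups, as a map of Lie algebras. The tangent
space at `f 1` and the Lie algebra of `G'` are both the model space `E'` by definition, so no proof
of `f 1 = 1` enters. -/
noncomputable def differentialOne (f : G → G') : GroupLieAlgebra I G →L[𝕜] GroupLieAlgebra J G' :=
  (mfderiv I J f 1 : E →L[𝕜] E')

variable [LieGroup I (minSmoothness 𝕜 3) G] [LieGroup J (minSmoothness 𝕜 3) G']

theorem mdifferentiable_mul_left (g : G) : MDifferentiable I I (g * ·) :=
  contMDiff_mul_left.mdifferentiable (n := minSmoothness 𝕜 3)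
    (lt_of_lt_of_le (by simp) le_minSmoothness).ne'

theorem mfderiv_mulInvariantVectorField (F : G →* G') (hF : MDifferentiable I J F)
    (v : GroupLieAlgebra I G) (p : G) :
    mfderiv I J F p (mulInvariantVectorField v p) =
      mulInvariantVectorField (differentialOne I J F v) (F p) := by
  have hcomm : F ∘ (p * ·) = (F p * ·) ∘ F := by ext x; simp
  have hleft : (mfderiv I J (F ∘ (p * ·)) 1 v : E') =
      mfderiv I J F p (mulInvariantVectorField v p) :=
    mfderiv_comp_apply_of_eq 1 (hF p) (mdifferentiable_mul_left p 1) (mul_one p) v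
  have hright : (mfderiv I J ((F p * ·) ∘ F) 1 v : E') =
      mulInvariantVectorField (differentialOne I J F v) (F p) :=
    mfderiv_comp_apply_of_eq 1 (mdifferentiable_mul_left (F p) 1) (hF 1) (map_one F) v
  exact hleft.symm.trans (hcomm ▸ hright)

theorem mpullback_mulInvariantVectorField_monoidHom {F : G →* G'} (hF : MDifferentiable I J F)
    (hF' : ∀ p, (mfderiv I J F p).IsInvertible) (v : GroupLieAlgebra I G) :
    mpullback I J F (mulInvariantVectorField (differentialOne I J F v)) =
      mulInvariantVectorField v := by
  ext p
  rw [mpullback_apply, (hF' p).inverse_apply_eq, mfderiv_mulInvariantVectorField F hF]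

theorem differentialOne_lie [CompleteSpace E] {F : G →* G'}
    (hF : ContMDiff I J (minSmoothness 𝕜 3) F) (hF' : ∀ p, (mfderiv I J F p).IsInvertible)
    (v w : GroupLieAlgebra I G) :
    differentialOne I J F ⁅v, w⁆ = ⁅differentialOne I J F v, differentialOne I J F w⁆ := by
  have hdiff : MDifferentiable I J F :=
    hF.mdifferentiable (lt_of_lt_of_le (by simp) le_minSmoothness).ne'
  have hbracket := mpullback_mlieBracket (x₀ := 1)
    (mdifferentiableAt_mulInvariantVectorField (differentialOne I J F v))
    (mdifferentiableAt_mulInvariantVectorField (differentialOne I J F w))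
    (hF 1) (minSmoothness_monotone (by norm_cast))
  rw [mpullback_mulInvariantVectorField_monoidHom hdiff hF',
    mpullback_mulInvariantVectorField_monoidHom hdiff hF', mpullback_apply,
    (hF' 1).inverse_apply_eq] at hbracket
  have mlieBracket_at_one (q : G') (hq : q = 1) :
      (mlieBracket J (mulInvariantVectorField (differentialOne I J F v))
        (mulInvariantVectorField (differentialOne I J F w)) q : E') =
      ⁅differentialOne I J F v, differentialOne I J F w⁆ := by rw [hq]; rfl
  exact hbracket.symm.trans (mlieBracket_at_one (F 1) (map_one F))

/-- The isomorphism of Lie algebras induced by a homomorphism of Lie groups which is a local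
diffeomorphism. -/
noncomputable def differentialLieEquiv [CompleteSpace E] [CompleteSpace E'] (F : G →* G')
    (hF : ContMDiff I J (minSmoothness 𝕜 3) F) (hF' : ∀ p, (mfderiv I J F p).IsInvertible) :
    GroupLieAlgebra I G ≃ₗ⁅𝕜⁆ GroupLieAlgebra J G' :=
  LieEquiv.ofBijective { (differentialOne I J F).toLinearMap with
    map_lie' := fun {v w} => differentialOne_lie hF hF' v w } (hF' 1).bijective

end Differential

section IntegralCurves

theorem mul_norm_le_of_norm_deriv_sub_le {E : Type*} [NormedAddCommGroup E] [NormedSpace ℝ E]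
    {f f' : ℝ → E} {a : ℝ} {w : E} (ha : 0 ≤ a)
    (hf : ∀ s ∈ Set.Icc 0 a, HasDerivWithinAt f (f' s) (Set.Icc 0 a) s)
    (hf' : ∀ s ∈ Set.Icc 0 a, ‖f' s - w‖ ≤ 1 / 2 * ‖w‖) : a * ‖w‖ ≤ 2 * ‖f a - f 0‖ := by
  have hsub : ‖(f a - a • w) - (f 0 - (0 : ℝ) • w)‖ ≤ 1 / 2 * ‖w‖ * (a - 0) :=
    norm_image_sub_le_of_norm_deriv_le_segment'
      (fun s hs => ((hf s hs).sub ((hasDerivWithinAt_id s _).smul_const w)).congr_deriv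
        (by rw [one_smul]))
      (fun s hs => hf' s (Set.Ico_subset_Icc_self hs)) a ⟨ha, le_rfl⟩
  have htri : a * ‖w‖ ≤ ‖f a - f 0‖ + ‖(f a - a • w) - (f 0 - (0 : ℝ) • w)‖ := by
    calc a * ‖w‖ = ‖(f a - f 0) - ((f a - a • w) - (f 0 - (0 : ℝ) • w))‖ := by
          rw [show (f a - f 0) - ((f a - a • w) - (f 0 - (0 : ℝ) • w)) = a • w by module,
            norm_smul, Real.norm_of_nonneg ha]
      _ ≤ _ := norm_sub_le _ _
  linarith

variable {E H G : Type*} [NormedAddCommGroup E] [NormedSpace ℝ E] [TopologicalSpace H]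
  {I : ModelWithCorners ℝ E H} [TopologicalSpace G] [ChartedSpace H G] [Group G]
  [LieGroup I (minSmoothness ℝ 3) G]
  {E' H' G' : Type*} [NormedAddCommGroup E'] [NormedSpace ℝ E'] [TopologicalSpace H']
  {J : ModelWithCorners ℝ E' H'} [TopologicalSpace G'] [ChartedSpace H' G'] [Group G']
  [LieGroup J (minSmoothness ℝ 3) G']

theorem isMIntegralCurveOn_monoidHom_comp {F : G →* G'} (hF : MDifferentiable I J F)
    {γ : ℝ → G} {v : GroupLieAlgebra I G} {s : Set ℝ}
    (hγ : IsMIntegralCurveOn γ (mulInvariantVectorField v) s) :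
    IsMIntegralCurveOn (F ∘ γ) (mulInvariantVectorField (differentialOne I J F v)) s := by
  intro t ht
  refine ((hF (γ t)).hasMFDerivAt.comp_hasMFDerivWithinAt t (hγ t ht)).congr_mfderiv ?_
  ext
  exact (congrArg (mfderiv I J F (γ t)) (one_smul ℝ (mulInvariantVectorField v (γ t)))).trans
    ((mfderiv_mulInvariantVectorField F hF v (γ t)).trans (one_smul ℝ _).symm)

variable (I) in
/-- The map sending `v` to the value at `q` of the left invariant vector field of `v`, read in the
chart at `1`. Meaningful only for `q` in the source of that chart. -/
noncomputable def mulInvariantInChart (q : G) : E →L[ℝ] E :=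
  (tangentCoordChange I q 1 q).comp (mfderiv I I (q * ·) 1 : E →L[ℝ] E)

theorem mulInvariantInChart_one : mulInvariantInChart I (1 : G) = .id ℝ E := by
  have hmul : ((1 : G) * ·) = id := funext one_mul
  have hmfderiv : (mfderiv I I ((1 : G) * ·) 1 : E →L[ℝ] E) = .id ℝ E := by
    rw [hmul]; exact mfderiv_id
  ext v
  rw [mulInvariantInChart, hmfderiv]
  exact tangentCoordChange_self (mem_extChartAt_source 1)

theorem continuousAt_mulInvariantInChart_one [FiniteDimensional ℝ E] :
    ContinuousAt (mulInvariantInChart I : G → E →L[ℝ] E) 1 := by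
  refine continuousAt_clm_apply.2 fun v => ?_
  have hv := contMDiffAt_mulInvariantVectorField (I := I) (G := G) v (g := 1)
  rw [Bundle.contMDiffAt_section] at hv
  exact hv.continuousAt

theorem hasDerivWithinAt_extChartAt_one {γ : ℝ → G} {v : GroupLieAlgebra I G} {s : Set ℝ} {t : ℝ}
    (hγ : IsMIntegralCurveOn γ (mulInvariantVectorField v) s) (h0 : γ 0 = 1) (ht : t ∈ s)
    (hsource : γ t ∈ (extChartAt I (1 : G)).source) :
    HasDerivWithinAt (fun r => extChartAt I 1 (γ r)) (mulInvariantInChart I (γ t) v) s t := by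
  have hderiv := hγ.hasDerivWithinAt (t₀ := 0) ht (by rwa [h0])
  rw [h0] at hderiv
  exact hderiv

theorem exists_mem_nhds_one_mul_norm_le [FiniteDimensional ℝ E] :
    ∃ U ∈ 𝓝 (1 : G), ∀ (w : E) (γ : ℝ → G) (a : ℝ), 0 ≤ a → γ 0 = 1 →
      IsMIntegralCurveOn γ (mulInvariantVectorField (I := I) w) (Set.Icc 0 a) →
      Set.MapsTo γ (Set.Icc 0 a) U →
      a * ‖w‖ ≤ 2 * ‖extChartAt I 1 (γ a) - extChartAt I (1 : G) 1‖ := by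
  have hid : ∀ᶠ q in 𝓝 (1 : G), ‖mulInvariantInChart I q - .id ℝ E‖ < 1 / 2 := by
    refine (continuousAt_mulInvariantInChart_one.sub_const _).norm.eventually_lt_const ?_
    rw [mulInvariantInChart_one, sub_self, norm_zero]
    norm_num
  refine ⟨_, inter_mem (extChartAt_source_mem_nhds (I := I) 1) hid, ?_⟩
  intro w γ a ha h0 hγ hU
  have hderiv (s : ℝ) (hs : s ∈ Set.Icc 0 a) :=
    hasDerivWithinAt_extChartAt_one hγ h0 hs (hU hs).1
  have hbound (s : ℝ) (hs : s ∈ Set.Icc 0 a) :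
      ‖mulInvariantInChart I (γ s) w - w‖ ≤ 1 / 2 * ‖w‖ :=
    (mulInvariantInChart I (γ s) - .id ℝ E).le_of_opNorm_le (hU hs).2.le w
  simpa only [h0] using mul_norm_le_of_norm_deriv_sub_le ha hderiv hbound

theorem exists_isMIntegralCurveOn_mulInvariantVectorField [CompleteSpace E]
    [BoundarylessManifold I G] (v : GroupLieAlgebra I G) {U : Set G} (hU : U ∈ 𝓝 1) :
    ∃ γ : ℝ → G, ∃ a > 0, γ 0 = 1 ∧
      IsMIntegralCurveOn γ (mulInvariantVectorField v) (Set.Icc 0 a) ∧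
      Set.MapsTo γ (Set.Icc 0 a) U := by
  obtain ⟨γ, hγ0, hγ⟩ := exists_isMIntegralCurveAt_of_contMDiffAt_boundaryless (t₀ := 0)
    ((contMDiffAt_mulInvariantVectorField v (g := (1 : G))).of_le
      (le_trans (by norm_num) le_minSmoothness))
  have hγU : ∀ᶠ s in 𝓝 0, γ s ∈ U := hγ.continuousAt (by rwa [hγ0])
  obtain ⟨ε, hε, hball⟩ := Metric.nhds_basis_closedBall.eventually_iff.1 (hγ.and hγU)
  have hIcc : Set.Icc 0 ε ⊆ Metric.closedBall 0 ε := by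
    rw [Real.closedBall_eq_Icc, zero_add]
    exact Set.Icc_subset_Icc_left (by linarith)
  exact ⟨γ, ε, hε, hγ0, fun s hs => (hball (hIcc hs)).1.hasMFDerivWithinAt,
    fun s hs => (hball (hIcc hs)).2⟩

end IntegralCurves

section Stability

variable {E H G : Type*} [NormedAddCommGroup E] [NormedSpace ℝ E] [TopologicalSpace H]
  {I : ModelWithCorners ℝ E H} [TopologicalSpace G] [ChartedSpace H G] [Group G]

theorem tendsto_differentialOne_zero [LieGroup I (minSmoothness ℝ 3) G] [FiniteDimensional ℝ E]
    [BoundarylessManifold I G] {F : ℝ → G →* G} (hF : ∀ t, MDifferentiable I I (F t))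
    (h : IsAsymptoticallyStable (fun t => ⇑(F t)) 1) (v : GroupLieAlgebra I G) :
    Tendsto (fun t => differentialOne I I (F t) v) atTop (𝓝 0) := by
  have : CompleteSpace E := FiniteDimensional.complete ℝ E
  obtain ⟨hstable, W, hW, hattract⟩ := h
  obtain ⟨U, hU, hbound⟩ := exists_mem_nhds_one_mul_norm_le (I := I) (G := G)
  obtain ⟨V, hV, hVU⟩ := hstable U hU
  obtain ⟨γ, a, ha, hγ0, hγ, hγVW⟩ :=
    exists_isMIntegralCurveOn_mulInvariantVectorField v (inter_mem hV hW)
  let κ : G → E := extChartAt I 1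
  let w (t : ℝ) : E := differentialOne I I (F t) v
  have hnorm (t : ℝ) (ht : 0 ≤ t) : ‖w t‖ ≤ 2 * ‖κ (F t (γ a)) - κ 1‖ / a := by
    rw [le_div_iff₀' ha]
    exact hbound (w t) (F t ∘ γ) a ha.le (by simp [hγ0])
      (isMIntegralCurveOn_monoidHom_comp (hF t) hγ)
      fun s hs => hVU t ht ⟨γ s, (hγVW hs).1, rfl⟩
  have hlim : Tendsto (fun t => 2 * ‖κ (F t (γ a)) - κ 1‖ / a) atTop (𝓝 0) := by
    have hκ : Tendsto (fun t => κ (F t (γ a))) atTop (𝓝 (κ 1)) :=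
      (continuousAt_extChartAt (I := I) 1).tendsto.comp
        (hattract (γ a) (hγVW (Set.right_mem_Icc.2 ha.le)).2)
    simpa using ((hκ.sub_const (κ 1)).norm.const_mul 2).div_const a
  exact squeeze_zero_norm' (E := E) ((eventually_ge_atTop 0).mono hnorm) hlim

theorem IsAsymptoticallyStable.one_of_isFixedPoint {G : Type*} [Group G] [TopologicalSpace G]
    [SeparatelyContinuousMul G] {F : ℝ → G →* G} {g : G}
    (h : IsAsymptoticallyStable (fun t => ⇑(F t)) g) (hg : IsFixedPoint (fun t => ⇑(F t)) g) :
    IsAsymptoticallyStable (fun t => ⇑(F t)) 1 := by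
  have hconj (t : ℝ) (x : G) : g⁻¹ * F t (g * x) = F t x := by
    rw [map_mul, show F t g = g from hg t, inv_mul_cancel_left]
  have hmul : Tendsto (g * ·) (𝓝 1) (𝓝 g) := by
    simpa using (continuous_const_mul g).tendsto (1 : G)
  have hinv : Tendsto (g⁻¹ * ·) (𝓝 g) (𝓝 1) := by
    simpa using (continuous_const_mul g⁻¹).tendsto g
  obtain ⟨hstable, W, hW, hattract⟩ := h
  refine ⟨fun U hU => ?_, _, hmul hW, fun x hx => ?_⟩
  · obtain ⟨V, hV, hVU⟩ := hstable _ (hinv hU)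
    refine ⟨_, hmul hV, fun t ht => ?_⟩
    rintro _ ⟨x, hx, rfl⟩
    have hmem : g⁻¹ * F t (g * x) ∈ U := hVU t ht ⟨g * x, hx, rfl⟩
    rwa [hconj] at hmem
  · exact (hinv.comp (hattract (g * x) hx)).congr fun t => hconj t x

end Stability

section Riemannian

variable {E : Type*} [NormedAddCommGroup E] [NormedSpace ℝ E]
  {G : Type*} [TopologicalSpace G] [ChartedSpace E G] [IsManifold 𝓘(ℝ, E) 1 G] [RegularSpace G]
  {m : Bundle.ContMDiffRiemannianMetric 𝓘(ℝ, E) ∞ E (fun x : G => TangentSpace 𝓘(ℝ, E) x)}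
  {φ : ℝ → G → G} {g : G}

theorem nhds_hasBasis_metricDist
    (m : Bundle.ContMDiffRiemannianMetric 𝓘(ℝ, E) ∞ E (fun x : G => TangentSpace 𝓘(ℝ, E) x))
    (g : G) : (𝓝 g).HasBasis (0 < ·) fun r => {x | metricDist m x g < r} := by
  let : Bundle.RiemannianBundle (fun x : G => TangentSpace 𝓘(ℝ, E) x) :=
    ⟨m.toRiemannianMetric⟩
  have : IsContinuousRiemannianBundle E (fun x : G => TangentSpace 𝓘(ℝ, E) x) :=
    ⟨⟨m.inner, m.contMDiff.continuous, fun _ _ _ => rfl⟩⟩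
  let := PseudoEMetricSpace.ofRiemannianMetric 𝓘(ℝ, E) G
  exact Metric.nhds_basis_eball

theorem IsExponentiallyStable.isStable (h : IsExponentiallyStable m φ g) : IsStable φ g := by
  obtain ⟨c, μ, hc, hμ, W, hW, hdecay⟩ := h
  intro U hU
  obtain ⟨r, hr, hrU⟩ := (nhds_hasBasis_metricDist m g).mem_iff.1 hU
  have hball : {x | metricDist m x g < r / ENNReal.ofReal c} ∈ 𝓝 g :=
    (nhds_hasBasis_metricDist m g).mem_of_mem (ENNReal.div_pos hr.ne' ENNReal.ofReal_ne_top)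
  refine ⟨_, inter_mem hW hball, ?_⟩
  rintro t ht _ ⟨x, ⟨hxW, hxr⟩, rfl⟩
  have hexp : c * Real.exp (-μ * t) ≤ c :=
    mul_le_of_le_one_right hc.le (Real.exp_le_one_iff.2 (by nlinarith))
  refine hrU ?_
  calc metricDist m (φ t x) g
    _ ≤ ENNReal.ofReal (c * Real.exp (-μ * t)) * metricDist m x g := hdecay x hxW t ht
    _ ≤ ENNReal.ofReal c * metricDist m x g := by gcongr
    _ < r := ENNReal.mul_lt_of_lt_div' hxr

theorem IsExponentiallyStable.isAsymptoticallyStable (h : IsExponentiallyStable m φ g) :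
    IsAsymptoticallyStable φ g := by
  refine ⟨h.isStable, ?_⟩
  obtain ⟨c, μ, -, hμ, W, hW, hdecay⟩ := h
  have hball : {x | metricDist m x g < 1} ∈ 𝓝 g :=
    (nhds_hasBasis_metricDist m g).mem_of_mem one_pos
  refine ⟨_, inter_mem hW hball, fun x ⟨hxW, hx1⟩ => ?_⟩
  have hrate : Tendsto (fun t : ℝ => ENNReal.ofReal (c * Real.exp (-μ * t))) atTop (𝓝 0) := by
    have hexp : Tendsto (fun t : ℝ => Real.exp (-μ * t)) atTop (𝓝 0) :=
      Real.tendsto_exp_atBot.comp (tendsto_id.const_mul_atTop_of_neg (neg_lt_zero.2 hμ))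
    simpa using ENNReal.tendsto_ofReal (hexp.const_mul c)
  refine (nhds_hasBasis_metricDist m g).tendsto_right_iff.2 fun r hr => ?_
  filter_upwards [hrate.eventually_lt_const hr, eventually_ge_atTop 0] with t htr ht
  calc metricDist m (φ t x) g
    _ ≤ ENNReal.ofReal (c * Real.exp (-μ * t)) * metricDist m x g := hdecay x hxW t ht
    _ ≤ ENNReal.ofReal (c * Real.exp (-μ * t)) := mul_le_of_le_one_right' hx1.le
    _ < r := htr

end Riemannian

section Automorphisms

variable {E : Type*} [NormedAddCommGroup E] [NormedSpace ℝ E]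
  {G : Type*} [TopologicalSpace G] [ChartedSpace E G]

theorem IsLinearVectorField.isLieGroupAutomorphism [T2Space G]
    [IsManifold 𝓘(ℝ, E) 1 G] [Group G] {X : ∀ g : G, TangentSpace 𝓘(ℝ, E) g} {φ : ℝ → G → G}
    (hX : IsLinearVectorField X) (hφ : IsFlow X φ) (t : ℝ) : IsLieGroupAutomorphism E (φ t) := by
  obtain ⟨hsmooth, ψ, hψ, hψaut⟩ := hX
  have hunique : φ t = ψ t := funext fun g => congrFun
    (isMIntegralCurve_Ioo_eq_of_contMDiff_boundaryless (t₀ := 0) (hsmooth.of_le (by simp))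
      (hφ g).2 (hψ g).2 ((hφ g).1.trans (hψ g).1.symm)) t
  exact hunique ▸ hψaut t

theorem nontrivial_of_chartedSpace_of_connectedSpace (H M : Type*) [TopologicalSpace H]
    [TopologicalSpace M] [ChartedSpace H M] [ConnectedSpace M] [Nontrivial M] : Nontrivial H := by
  by_contra! hH
  have : DiscreteTopology M := ChartedSpace.discreteTopology H M
  exact not_subsingleton M PreconnectedSpace.trivial_of_discrete

theorem IsAsymptoticallyStable.isNilpotent_groupLieAlgebra [FiniteDimensional ℝ E] [Group G]
    [LieGroup 𝓘(ℝ, E) ∞ G] {φ : ℝ → G → G} {g : G} (h : IsAsymptoticallyStable φ g)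
    (hφ : ∀ t, IsLieGroupAutomorphism E (φ t)) (hg : IsFixedPoint φ g) :
    LieRing.IsNilpotent (GroupLieAlgebra 𝓘(ℝ, E) G) := by
  have : IsTopologicalGroup G := topologicalGroup_of_lieGroup 𝓘(ℝ, E) ∞
  have : CompleteSpace E := FiniteDimensional.complete ℝ E
  have : FiniteDimensional ℝ (GroupLieAlgebra 𝓘(ℝ, E) G) := inferInstanceAs (FiniteDimensional ℝ E)
  have : T2Space (GroupLieAlgebra 𝓘(ℝ, E) G) := inferInstanceAs (T2Space E)
  choose F hF hsmooth hsmooth_symm using hφ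
  let F' (t : ℝ) : G →* G := F t
  obtain rfl : φ = fun t => ⇑(F' t) := funext fun t => funext fun x => (hF t x).symm
  have hone : IsAsymptoticallyStable (fun t => ⇑(F' t)) 1 := h.one_of_isFixedPoint hg
  have hdiff (t : ℝ) : MDifferentiable 𝓘(ℝ, E) 𝓘(ℝ, E) (F' t) :=
    (hsmooth t).mdifferentiable (by simp)
  let Φ (t : ℝ) : G ≃ₘ^∞⟮𝓘(ℝ, E), 𝓘(ℝ, E)⟯ G := ⟨(F t).toEquiv, hsmooth t, hsmooth_symm t⟩
  let A (t : ℝ) := differentialLieEquiv (F' t) ((hsmooth t).of_le ENat.LEInfty.out)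
    fun p => ⟨(Φ t).mfderivToContinuousLinearEquiv (by simp) p, rfl⟩
  exact isNilpotent_of_tendsto_lieEquiv_zero (A := A) (tendsto_differentialOne_zero hdiff hone)

end Automorphisms

end LinearFlow

theorem mainTheorem8_general {E : Type*} [NormedAddCommGroup E] [NormedSpace ℝ E]
    [FiniteDimensional ℝ E] {G : Type*} [TopologicalSpace G] [ChartedSpace E G] [Group G]
    [LieGroup 𝓘(ℝ, E) ∞ G] (hG : ¬ LieRing.IsNilpotent (GroupLieAlgebra 𝓘(ℝ, E) G))
    (φ : ℝ → G → G) (hφ : ∀ t, LinearFlow.IsLieGroupAutomorphism E (φ t))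
    (g : G) (hg : LinearFlow.IsFixedPoint φ g) :
    ¬ LinearFlow.IsAsymptoticallyStable φ g ∧
      ∀ m : Bundle.ContMDiffRiemannianMetric 𝓘(ℝ, E) ∞ E
        (fun x : G => TangentSpace 𝓘(ℝ, E) x),
        ¬ LinearFlow.IsExponentiallyStable m φ g := by
  have : IsTopologicalGroup G := topologicalGroup_of_lieGroup 𝓘(ℝ, E) ∞
  have hnot : ¬ LinearFlow.IsAsymptoticallyStable φ g :=
    fun h => hG (h.isNilpotent_groupLieAlgebra hφ hg)
  exact ⟨hnot, fun m h => hnot h.isAsymptoticallyStable⟩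

theorem mainTheorem8 {E : Type*} [NormedAddCommGroup E] [NormedSpace ℝ E] [FiniteDimensional ℝ E]
    {G : Type*} [TopologicalSpace G] [ChartedSpace E G] [Group G] [LieGroup 𝓘(ℝ, E) ∞ G]
    [T2Space G] [ConnectedSpace G] [Nontrivial G]
    [LieAlgebra.IsSemisimple ℝ (GroupLieAlgebra 𝓘(ℝ, E) G)]
    (X : ∀ g : G, TangentSpace 𝓘(ℝ, E) g) (hX : LinearFlow.IsLinearVectorField X)
    (φ : ℝ → G → G) (hφ : LinearFlow.IsFlow X φ)
    (g : G) (hg : LinearFlow.IsFixedPoint φ g) :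
    ¬ LinearFlow.IsAsymptoticallyStable φ g ∧
      ∀ m : Bundle.ContMDiffRiemannianMetric 𝓘(ℝ, E) ∞ E
        (fun x : G => TangentSpace 𝓘(ℝ, E) x),
        ¬ LinearFlow.IsExponentiallyStable m φ g := by
  have : Nontrivial (GroupLieAlgebra 𝓘(ℝ, E) G) :=
    LinearFlow.nontrivial_of_chartedSpace_of_connectedSpace E G
  have hG : ¬ LieRing.IsNilpotent (GroupLieAlgebra 𝓘(ℝ, E) G) :=
    LinearFlow.not_isNilpotent_of_hasTrivialRadical ℝ _
  exact mainTheorem8_general hG φ (hX.isLieGroupAutomorphism hφ) g hg
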